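/- Let $n,p\ge 1$, $A\in\mathbb R^{n\times p}$, $b\in\mathbb R^n$, $\lambda>0$, and let $f:\mathbb R^p\to\mathbb R$. For $u\in\mathbb R^n$ let $\|u_+\|_0$ be the number of positive components of $u$, and consider the zero-one composite optimization problem (0/1-COP) $$\min_{w\in\mathbb R^p,\,u\in\mathbb R^n} f(w)+\lambda\|u_+\|_0\quad\text{s.t.}\quad Aw+b=u .$$ For $\alpha>0$ let $\mathrm{Prox}_{\alpha\lambda\|(\cdot)_+\|_0}(z)=\arg\min_{u\in\mathbb R^n}\ \lambda\|u_+\|_0+\frac1{2\alpha}\|u-z\|^2$ (a set). A triplet $(w^*,u^*,z^*)$ is a P-stationary triplet of the 0/1-COP if for some $\alpha>0$ $$\nabla f(w^*)+A^\top z^*=0,\qquad u^*\in \mathrm{Prox}_{\alpha\lambda\|(\cdot)_+\|_0}(u^*+\alpha z^*),\qquad Aw^*+b-u^*=0 .$$ For $\rho,\mu>0$ put $$h_{z,v}(w,u)=f(w)+\frac\mu2\|w-v\|^2+\langle z,Aw+b-u\rangle+\frac\rho2\|Aw+b-u\|^2,\qquad \mathcal V_{\rho,\mu}(w,u,z,v)=h_{z,v}(w,u)+\lambda\|u_+\|_0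 .$$ Given positive numbers $\epsilon_k$ $(k\in\mathbb N)$, a sequence $(w^k,u^k,z^k,v^k)_{k\in\mathbb N}$ in $\mathbb R^p\times\mathbb R^n\times\mathbb R^n\times\mathbb R^p$ with arbitrary starting point is generated by the inexact augmented Lagrangian method (IALM) if, for every $k\ge0$, with $\alpha=1/\rho$ and $h_k=h_{z^k,v^k}$, the point $(w^{k+1},u^{k+1})$ (found by any inner solver) satisfies $$\mathcal V_{\rho,\mu}(w^{k+1},u^{k+1},z^k,v^k)\le \mathcal V_{\rho,\mu}(w^{k},u^{k},z^k,v^k),$$ $$\max\bigl\{\mathrm{dist}\bigl(u^{k+1},\mathrm{Prox}_{\alpha\lambda\|(\cdot)_+\|_0}(u^{k+1}-\alpha\nabla_u h_k(w^{k+1},u^{k+1}))\bigr),\ \|\nabla_w h_k(w^{k+1},u^{k+1})\|\bigr\}\le\epsilon_k,$$ and $z^{k+1}=z^k+\rho(Aw^{k+1}+b-u^{k+1})$, $v^{k+1}=w^{k+1}$. **Theorem (Whole Sequence Convergence).** Assume that $f$ is $l_f$-smooth (differentiable with $l_f$-Lipschitz gradient) and strongly convex, and that $A$ has full row rank. Let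 $\gamma=\sqrt{\theta_{\min}(AA^\top)}>0$, where $\theta_{\min}$ denotes the smallest eigenvalue, let $\mu>0$, $c_1=(\mu+l_f)/\gamma$, $c_2=\mu/\gamma$, and let $$\rho>\max\Bigl\{\frac{16(c_1^2+c_2^2)}{\mu},\frac{6l_f}{\gamma^2}\Bigr\},\qquad \eta>\frac4{\rho\gamma^2},\qquad \frac{\epsilon_{k+1}}{\epsilon_k}\le\sqrt{\frac{\rho\gamma^2\eta-4}{\rho\gamma^2\eta+4}}\quad(k\in\mathbb N).$$ If $(w^k,u^k,z^k,v^k)_{k\in\mathbb N}$ is a sequence generated by IALM, then there are $w^*\in\mathbb R^p$ and $u^*,z^*\in\mathbb R^n$ such that $\lim_{k\to\infty}(w^k,u^k,z^k,v^k)=(w^*,u^*,z^*,w^*)$, $(w^*,u^*,z^*)$ is a P-stationary triplet of the 0/1-COP, and $(w^*,u^*)$ is a local minimizer of the 0/1-COP. -/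

import Mathlib

open Filter Topology

noncomputable section

namespace ZeroOneCOP

/-- `ℝᵈ` with its Euclidean norm. -/
abbrev Vec (d : ℕ) : Type := EuclideanSpace ℝ (Fin d)

/-- The matrix-vector product `A x`, as a Euclidean vector. -/
def mulE {n p : ℕ} (A : Matrix (Fin n) (Fin p) ℝ) (x : Vec p) : Vec n :=
  WithLp.toLp 2 (A.mulVec (WithLp.ofLp x))

/-- `‖u₊‖₀`: the number of nonzero entries of the vector `u₊ = (max 0 uᵢ)ᵢ`. -/
def posZeroNorm {n : ℕ} (u : Vec n) : ℝ :=
  (hammingNorm (fun i : Fin n => max 0 (u i)) : ℝ)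

/-- The proximal operator `Prox_{α g}(z) = argmin_u g(u) + ‖u - z‖² / (2 α)`, a set. -/
def Prox {n : ℕ} (g : Vec n → ℝ) (α : ℝ) (z : Vec n) : Set (Vec n) :=
  {u | ∀ y : Vec n, g u + 1 / (2 * α) * ‖u - z‖ ^ 2 ≤ g y + 1 / (2 * α) * ‖y - z‖ ^ 2}

/-- `Prox_{α lam ‖(·)₊‖₀}(z)`. -/
def posProx {n : ℕ} (lam α : ℝ) (z : Vec n) : Set (Vec n) :=
  Prox (fun u => lam * posZeroNorm u) α z

/-- `f` is `l`-smooth: differentiable, with `l`-Lipschitz gradient. -/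
def IsSmooth {p : ℕ} (f : Vec p → ℝ) (l : ℝ) : Prop :=
  Differentiable ℝ f ∧ ∀ x y : Vec p, ‖gradient f x - gradient f y‖ ≤ l * ‖x - y‖

/-- `f` is strongly convex (with some positive modulus). -/
def IsStronglyConvex {p : ℕ} (f : Vec p → ℝ) : Prop :=
  ∃ σ : ℝ, 0 < σ ∧ StrongConvexOn Set.univ σ f

/-- `γ = √θ_min(A Aᵀ)`, where `θ_min` is the smallest eigenvalue (`n ≥ 1`). -/
def gammaOf {n p : ℕ} (A : Matrix (Fin n) (Fin p) ℝ) : ℝ :=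
  Real.sqrt (sInf (spectrum ℝ (A * A.transpose)))

/-- The objective `f(w) + lam ‖u₊‖₀` of the 0/1-COP. -/
def objective {n p : ℕ} (f : Vec p → ℝ) (lam : ℝ) (x : Vec p × Vec n) : ℝ :=
  f x.1 + lam * posZeroNorm x.2

/-- The feasible set `{(w, u) : A w + b = u}` of the 0/1-COP. -/
def feasible {n p : ℕ} (A : Matrix (Fin n) (Fin p) ℝ) (b : Vec n) : Set (Vec p × Vec n) :=
  {x | mulE A x.1 + b = x.2}

/-- `(w, u)` is a local minimizer of `min f(w) + lam ‖u₊‖₀` subject to `A w + b = u`. -/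
def IsLocalMinimizer {n p : ℕ} (f : Vec p → ℝ) (lam : ℝ) (A : Matrix (Fin n) (Fin p) ℝ)
    (b : Vec n) (w : Vec p) (u : Vec n) : Prop :=
  (w, u) ∈ feasible A b ∧ IsLocalMinOn (objective f lam) (feasible A b) (w, u)

/-- `(w, u, z)` is a P-stationary triplet of the 0/1-COP. -/
def IsPStationaryTriplet {n p : ℕ} (f : Vec p → ℝ) (lam : ℝ) (A : Matrix (Fin n) (Fin p) ℝ)
    (b : Vec n) (w : Vec p) (u z : Vec n) : Prop :=
  ∃ α : ℝ, 0 < α ∧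
    gradient f w + mulE A.transpose z = 0 ∧
    u ∈ posProx lam α (u + α • z) ∧
    mulE A w + b - u = 0

/-- The augmented Lagrangian `L_ρ(w, u, z)`. -/
def augLagrangian {n p : ℕ} (f : Vec p → ℝ) (lam : ℝ) (A : Matrix (Fin n) (Fin p) ℝ)
    (b : Vec n) (ρ : ℝ) (w : Vec p) (u z : Vec n) : ℝ :=
  f w + lam * posZeroNorm u + inner ℝ z (mulE A w + b - u)
    + ρ / 2 * ‖mulE A w + b - u‖ ^ 2

/-- The Lyapunov function `V_{ρ,μ}(w, u, z, v)`. -/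
def lyapunov {n p : ℕ} (f : Vec p → ℝ) (lam : ℝ) (A : Matrix (Fin n) (Fin p) ℝ)
    (b : Vec n) (ρ μ : ℝ) (w : Vec p) (u z : Vec n) (v : Vec p) : ℝ :=
  augLagrangian f lam A b ρ w u z + μ / 2 * ‖w - v‖ ^ 2

/-- The differentiable part of `V_{ρ,μ}(·, ·, z, v)`; `h_k` is the case `z = zᵏ`, `v = vᵏ`. -/
def hFun {n p : ℕ} (f : Vec p → ℝ) (A : Matrix (Fin n) (Fin p) ℝ)
    (b : Vec n) (ρ μ : ℝ) (z : Vec n) (v : Vec p) (w : Vec p) (u : Vec n) : ℝ :=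
  f w + μ / 2 * ‖w - v‖ ^ 2 + inner ℝ z (mulE A w + b - u)
    + ρ / 2 * ‖mulE A w + b - u‖ ^ 2

/-- `(wᵏ, uᵏ, zᵏ, vᵏ)` is a sequence generated by IALM with stopping tolerances `ε k`.
The starting point is arbitrary; `(wᵏ⁺¹, uᵏ⁺¹)` may be any point that passes the stopping
criteria (`descent` and `crit`) of the `k`-th subproblem, whichever inner solver found it.
The proximal parameter is `α = 1 / ρ`. -/
structure IsIALMSequence {n p : ℕ} (f : Vec p → ℝ) (lam : ℝ) (A : Matrix (Fin n) (Fin p) ℝ)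
    (b : Vec n) (ρ μ : ℝ) (ε : ℕ → ℝ)
    (w : ℕ → Vec p) (u z : ℕ → Vec n) (v : ℕ → Vec p) : Prop where
  descent : ∀ k, lyapunov f lam A b ρ μ (w (k + 1)) (u (k + 1)) (z k) (v k)
    ≤ lyapunov f lam A b ρ μ (w k) (u k) (z k) (v k)
  crit : ∀ k,
    max
      (Metric.infDist (u (k + 1))
        (posProx lam (1 / ρ)
          (u (k + 1) - (1 / ρ) •
            gradient (fun y => hFun f A b ρ μ (z k) (v k) (w (k + 1)) y) (u (k + 1)))))
      ‖gradient (fun x => hFun f A b ρ μ (z k) (v k) x (u (k + 1))) (w (k + 1))‖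
    ≤ ε k
  multiplier : ∀ k, z (k + 1) = z k + ρ • (mulE A (w (k + 1)) + b - u (k + 1))
  lyapunovStep : ∀ k, v (k + 1) = w (k + 1)

end ZeroOneCOP

end

/-! ### Convexity -/

/-! The multiplier update raises the augmented Lagrangian by `‖Δz‖² / ρ`, and everything rests on
paying for this rise. Full row rank gives `γ‖y‖ ≤ ‖Aᵀy‖`, and near-stationarity in `w` writes `Aᵀz`
as `-∇f(w) - μ(w - v)` up to the tolerance. So `Δz` is controlled by two consecutive proximal steps
and two tolerances; large `ρ` and the decay of `ε` let the proximal term absorb it, and `potential`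
decreases (`IsIALMSequence.potential_descent`). It is bounded below because `‖∇f‖² ≤ 4l(f - m)`
controls `‖z‖² / ρ` by a fraction of `f - m` (`IsIALMSequence.le_potential`). Hence steps and
residuals vanish, and strong convexity bounds the iterates.

Every cluster point of `(w, z)` is stationary. By complementarity between `u` and `z`, each zero
pattern of `Aw + b` supports at most one stationary pair, so there are finitely many
(`finite_setOf_stationary`). A bounded sequence with vanishing steps and finitely many cluster
points converges. No Kurdyka–Łojasiewicz argument is needed.

Local minimality follows from convexity: near the limit, either the count of positive entries jumps
and `lam` outweighs the linear term, or the signs of the multiplier make the linear term harmless.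
-/

/-- Divide the strong convexity inequality on the segment from `x` to `y` by `t` and let `t`
decrease to `0`. -/
theorem StrongConvexOn.add_inner_gradient_le {E : Type*} [NormedAddCommGroup E]
    [InnerProductSpace ℝ E] [CompleteSpace E] {f : E → ℝ} {σ : ℝ}
    (hf : StrongConvexOn Set.univ σ f) {x : E} (hd : DifferentiableAt ℝ f x) (y : E) :
    f x + inner ℝ (gradient f x) (y - x) + σ / 2 * ‖y - x‖ ^ 2 ≤ f y := by
  have hline : HasDerivAt (fun t : ℝ => x + t • (y - x)) (y - x) 0 := by
    simpa using ((hasDerivAt_id (0 : ℝ)).smul_const (y - x)).const_add x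
  have hfd : HasFDerivAt f (fderiv ℝ f x) (x + (0 : ℝ) • (y - x)) := by
    simpa using hd.hasFDerivAt
  have hder : HasDerivAt (fun t : ℝ => f (x + t • (y - x))) (inner ℝ (gradient f x) (y - x)) 0 := by
    rw [inner_gradient_left]
    exact hfd.comp_hasDerivAt 0 hline
  have hslope := hder.tendsto_slope_zero_right
  simp only [zero_add, zero_smul, add_zero, smul_eq_mul] at hslope
  have hright : Tendsto (fun t : ℝ => f y - f x - (1 - t) * (σ / 2 * ‖y - x‖ ^ 2)) (𝓝[>] 0)
      (𝓝 (f y - f x - (1 - 0) * (σ / 2 * ‖y - x‖ ^ 2))) :=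
    tendsto_nhdsWithin_of_tendsto_nhds (Continuous.tendsto (by fun_prop) 0)
  have hle := le_of_tendsto_of_tendsto hslope hright (by
    filter_upwards [Ioo_mem_nhdsGT (zero_lt_one (α := ℝ))] with t ht
    have h := hf.2 (Set.mem_univ x) (Set.mem_univ y) (by linarith [ht.2] : 0 ≤ 1 - t) ht.1.le
      (by ring)
    rw [show (1 - t) • x + t • y = x + t • (y - x) by module, norm_sub_rev x y] at h
    simp only [smul_eq_mul] at h
    rw [inv_mul_le_iff₀ ht.1]
    linarith)
  linarith

theorem StrongConvexOn.mul_norm_sq_le_inner_gradient {E : Type*} [NormedAddCommGroup E]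
    [InnerProductSpace ℝ E] [CompleteSpace E] {f : E → ℝ} {σ : ℝ}
    (hf : StrongConvexOn Set.univ σ f) (hd : Differentiable ℝ f) (x y : E) :
    σ * ‖x - y‖ ^ 2 ≤ inner ℝ (gradient f x - gradient f y) (x - y) := by
  have h₁ := hf.add_inner_gradient_le (hd x) y
  have h₂ := hf.add_inner_gradient_le (hd y) x
  rw [← neg_sub x y, inner_neg_right, norm_neg] at h₁
  rw [inner_sub_left]
  linarith

theorem StrongConvexOn.exists_lower_bound {E : Type*} [NormedAddCommGroup E]
    [InnerProductSpace ℝ E] [CompleteSpace E] {f : E → ℝ} {σ : ℝ} (hσ : 0 < σ)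
    (hf : StrongConvexOn Set.univ σ f) (hd : Differentiable ℝ f) :
    ∃ m, ∀ x, m + σ / 4 * ‖x‖ ^ 2 ≤ f x := by
  refine ⟨f 0 - ‖gradient f 0‖ ^ 2 / σ, fun x => ?_⟩
  have h := hf.add_inner_gradient_le (hd 0) x
  simp only [sub_zero] at h
  have hin := neg_le_of_abs_le (abs_real_inner_le_norm (gradient f 0) x)
  have hsq : ‖gradient f 0‖ * ‖x‖ ≤ ‖gradient f 0‖ ^ 2 / σ + σ / 4 * ‖x‖ ^ 2 := by
    have : ‖gradient f 0‖ ^ 2 / σ + σ / 4 * ‖x‖ ^ 2 - ‖gradient f 0‖ * ‖x‖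
        = (‖gradient f 0‖ - σ / 2 * ‖x‖) ^ 2 / σ := by
      field_simp
      ring
    have : 0 ≤ (‖gradient f 0‖ - σ / 2 * ‖x‖) ^ 2 / σ := by positivity
    linarith
  linarith

/-- Compare `x` with the gradient step `y` of size `1 / (2l)`. Convexity at `y` stands in for the
descent lemma, at the price of `4l` in place of the sharp `2l`; this step size maximises `s - l s²`.
-/
theorem norm_gradient_sq_le_of_lower_bound {E : Type*} [NormedAddCommGroup E]
    [InnerProductSpace ℝ E] [CompleteSpace E] {f : E → ℝ} {σ l m : ℝ} (hσ : 0 < σ)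
    (hf : StrongConvexOn Set.univ σ f) (hd : Differentiable ℝ f) (hl : 0 < l)
    (hlip : ∀ x y, ‖gradient f x - gradient f y‖ ≤ l * ‖x - y‖) (hm : ∀ x, m ≤ f x) (x : E) :
    ‖gradient f x‖ ^ 2 ≤ 4 * l * (f x - m) := by
  set g := gradient f x with hg
  set y := x - (1 / (2 * l)) • g with hy
  have hyx : x - y = (1 / (2 * l)) • g := by rw [hy]; abel
  have h := hf.add_inner_gradient_le (hd y) x
  have hnorm : ‖x - y‖ = 1 / (2 * l) * ‖g‖ := by
    rw [hyx, norm_smul, Real.norm_of_nonneg (by positivity)]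
  have h₁ : inner ℝ g (x - y) = 1 / (2 * l) * ‖g‖ ^ 2 := by
    rw [hyx, inner_smul_right, real_inner_self_eq_norm_sq]
  have h₂ : inner ℝ (g - gradient f y) (x - y) ≤ l * (1 / (2 * l) * ‖g‖) ^ 2 := by
    refine (real_inner_le_norm _ _).trans ?_
    rw [← hnorm, sq, ← mul_assoc]
    exact mul_le_mul_of_nonneg_right (hlip x y) (norm_nonneg _)
  rw [inner_sub_left, h₁] at h₂
  have hnn : 0 ≤ σ / 2 * ‖x - y‖ ^ 2 := by positivity
  have hmy := hm y
  have hfin : 1 / (2 * l) * ‖g‖ ^ 2 - l * (1 / (2 * l) * ‖g‖) ^ 2 ≤ f x - m := by linarith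
  have heq : 1 / (2 * l) * ‖g‖ ^ 2 - l * (1 / (2 * l) * ‖g‖) ^ 2 = ‖g‖ ^ 2 / (4 * l) := by
    field_simp
    ring
  rw [heq, div_le_iff₀ (by positivity)] at hfin
  linarith

theorem lipschitz_const_pos {E : Type*} [NormedAddCommGroup E]
    [InnerProductSpace ℝ E] [CompleteSpace E] [Nontrivial E] {f : E → ℝ} {σ l : ℝ} (hσ : 0 < σ)
    (hf : StrongConvexOn Set.univ σ f) (hd : Differentiable ℝ f)
    (hlip : ∀ x y, ‖gradient f x - gradient f y‖ ≤ l * ‖x - y‖) : 0 < l := by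
  obtain ⟨x, hx⟩ := exists_ne (0 : E)
  have hx' : 0 < ‖x - 0‖ := by simpa using hx
  have h := (hf.mul_norm_sq_le_inner_gradient hd x 0).trans
    ((real_inner_le_norm _ _).trans (mul_le_mul_of_nonneg_right (hlip x 0) (norm_nonneg _)))
  by_contra! hl
  nlinarith [mul_pos hσ (pow_pos hx' 2), pow_pos hx' 2]

namespace ZeroOneCOP

/-! ### The matrix -/

/-- `mulE` as a continuous linear map. -/
noncomputable def mulCLM {n p : ℕ} (A : Matrix (Fin n) (Fin p) ℝ) : Vec p →L[ℝ] Vec n :=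
  LinearMap.toContinuousLinearMap (Matrix.toEuclideanLin A)

theorem mulE_eq_mulCLM {n p : ℕ} (A : Matrix (Fin n) (Fin p) ℝ) (x : Vec p) :
    mulE A x = mulCLM A x := rfl

theorem inner_mulE {n p : ℕ} (A : Matrix (Fin n) (Fin p) ℝ) (x : Vec p) (y : Vec n) :
    inner ℝ (mulE A x) y = inner ℝ x (mulE A.transpose y) := by
  simp only [mulE, EuclideanSpace.inner_eq_star_dotProduct, star_trivial]
  rw [Matrix.mulVec_transpose, ← Matrix.dotProduct_mulVec, dotProduct_comm]

theorem norm_mulE_transpose_sq {n p : ℕ} (A : Matrix (Fin n) (Fin p) ℝ) (y : Vec n) :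
    ‖mulE A.transpose y‖ ^ 2
      = dotProduct (WithLp.ofLp y) ((A * A.transpose).mulVec (WithLp.ofLp y)) := by
  rw [← real_inner_self_eq_norm_sq, ← inner_mulE]
  simp [mulE, EuclideanSpace.inner_eq_star_dotProduct, Matrix.mulVec_mulVec]

theorem gammaOf_pos {n p : ℕ} (hn : 0 < n) {A : Matrix (Fin n) (Fin p) ℝ} (hA : A.rank = n) :
    0 < gammaOf A := by
  -- For `n = 0` the spectrum is empty and `sInf` takes the default value `0`.
  have : Nonempty (Fin n) := ⟨⟨0, hn⟩⟩
  have hpd : (A * A.transpose).PosDef := by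
    have := Matrix.PosDef.mul_conjTranspose_self A (by
      rw [Matrix.vecMul_injective_iff, linearIndependent_iff_card_eq_finrank_span,
        Set.finrank,
        ← Matrix.rank_eq_finrank_span_row, hA, Fintype.card_fin])
    simpa using this
  have hsp := hpd.isHermitian.spectrum_real_eq_range_eigenvalues
  have hmem : sInf (spectrum ℝ (A * A.transpose)) ∈ spectrum ℝ (A * A.transpose) := by
    rw [hsp]
    exact (Set.range_nonempty _).csInf_mem (Set.finite_range _)
  refine Real.sqrt_pos.2 ?_
  rw [hsp] at hmem ⊢
  obtain ⟨i, hi⟩ := hmem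
  rw [← hi]
  exact hpd.eigenvalues_pos i

/-- `AAᵀ - θ` is positive semidefinite, since subtracting the scalar shifts the spectrum; evaluate
its quadratic form at `y`. -/
theorem gammaOf_mul_norm_le {n p : ℕ} (hn : 0 < n) {A : Matrix (Fin n) (Fin p) ℝ}
    (hA : A.rank = n) (y : Vec n) : gammaOf A * ‖y‖ ≤ ‖mulE A.transpose y‖ := by
  have hpos := gammaOf_pos hn hA
  have hθ : 0 < sInf (spectrum ℝ (A * A.transpose)) := Real.sqrt_pos.1 hpos
  have hH : (A * A.transpose).IsHermitian := by
    simpa using Matrix.isHermitian_mul_conjTranspose_self A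
  set θ := sInf (spectrum ℝ (A * A.transpose)) with hθdef
  have hbdd : BddBelow (spectrum ℝ (A * A.transpose)) := by
    rw [hH.spectrum_real_eq_range_eigenvalues]
    exact (Set.finite_range _).bddBelow
  have hps : (A * A.transpose - algebraMap ℝ (Matrix (Fin n) (Fin n) ℝ) θ).PosSemidef := by
    have hH' : (A * A.transpose - algebraMap ℝ (Matrix (Fin n) (Fin n) ℝ) θ).IsHermitian := by
      refine hH.sub ?_
      rw [Algebra.algebraMap_eq_smul_one]
      simp [Matrix.IsHermitian]
    rw [Matrix.posSemidef_iff_isHermitian_and_spectrum_nonneg]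
    refine ⟨hH', fun x hx => ?_⟩
    rw [← spectrum.sub_singleton_eq] at hx
    obtain ⟨a, ha, c, hc, rfl⟩ := Set.mem_sub.1 hx
    rw [Set.mem_singleton_iff.1 hc]
    exact sub_nonneg.2 (csInf_le hbdd ha)
  have h := hps.dotProduct_mulVec_nonneg (WithLp.ofLp y)
  rw [Matrix.sub_mulVec, dotProduct_sub, Algebra.algebraMap_eq_smul_one, Matrix.smul_mulVec,
    Matrix.one_mulVec, dotProduct_smul, star_trivial, ← norm_mulE_transpose_sq] at h
  have hy : dotProduct (WithLp.ofLp y) (WithLp.ofLp y) = ‖y‖ ^ 2 := by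
    rw [← real_inner_self_eq_norm_sq, EuclideanSpace.inner_eq_star_dotProduct, star_trivial]
  rw [hy, smul_eq_mul] at h
  refine le_of_sq_le_sq ?_ (norm_nonneg _)
  rw [mul_pow, gammaOf, Real.sq_sqrt hθ.le]
  linarith

end ZeroOneCOP

/-- A sequence with values in a compact set whose steps tend to zero and whose cluster points
form a finite set converges. -/
theorem exists_tendsto_of_finite_mapClusterPt {X : Type*} [MetricSpace X] {x : ℕ → X} {K : Set X}
    (hK : IsCompact K) (hx : ∀ k, x k ∈ K)
    (hstep : Tendsto (fun k => dist (x (k + 1)) (x k)) atTop (𝓝 0))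
    (hfin : {c | MapClusterPt c atTop x}.Finite) :
    ∃ c, Tendsto x atTop (𝓝 c) := by
  obtain ⟨c, -, hc⟩ := hK.exists_mapClusterPt_of_frequently
    (Frequently.of_forall hx : ∃ᶠ k in atTop, x k ∈ K)
  obtain ⟨δ, hδ, hiso⟩ := Metric.isOpen_iff.1 (hfin.subset Set.sdiff_subset).isClosed.isOpen_compl c
    (show c ∉ {c | MapClusterPt c atTop x} \ {c} by simp)
  refine ⟨c, Metric.tendsto_atTop.2 fun ε hε => ?_⟩
  set r := min (δ / 3) (ε / 2) with hr
  have hr0 : 0 < r := by positivity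
  have hrδ : r ≤ δ / 3 := min_le_left _ _
  have hrε : r ≤ ε / 2 := min_le_right _ _
  -- The closed annulus lies within `δ` of `c` and omits `c`, so it contains no cluster point and is
  -- eventually avoided. Steps shorter than its width `r` cannot jump over it.
  have hann : ∀ᶠ k in atTop, x k ∉ K ∩ {y | r ≤ dist y c ∧ dist y c ≤ 2 * r} := by
    by_contra hcon
    have hcpt : IsCompact (K ∩ {y | r ≤ dist y c ∧ dist y c ≤ 2 * r}) :=
      hK.inter_right (isClosed_Icc.preimage (by fun_prop : Continuous fun y => dist y c))
    obtain ⟨d, hd, hdc⟩ := hcpt.exists_mapClusterPt_of_frequently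
      (by simpa [Filter.Frequently] using hcon :
        ∃ᶠ k in atTop, x k ∈ K ∩ {y | r ≤ dist y c ∧ dist y c ≤ 2 * r})
    refine hiso (Metric.mem_ball.2 (by linarith [hd.2.2] : dist d c < δ)) ⟨hdc, ?_⟩
    rintro rfl
    have := hd.2.1
    rw [dist_self] at this
    linarith
  obtain ⟨N, hN⟩ := eventually_atTop.1 (hann.and (hstep.eventually (gt_mem_nhds hr0)))
  obtain ⟨M, hM, hMc⟩ := frequently_atTop.1 (hc.frequently (Metric.ball_mem_nhds c hr0)) N
  refine ⟨M, fun k hk => ?_⟩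
  suffices dist (x k) c < r by linarith
  induction k, hk using Nat.le_induction with
  | base => exact hMc
  | succ k hk ih =>
    by_contra! hcon
    refine (hN (k + 1) (by omega)).1 ⟨hx _, hcon, ?_⟩
    have h₁ := (hN k (by omega)).2
    linarith [dist_triangle (x (k + 1)) (x k) c]

namespace ZeroOneCOP

/-! ### The positive zero norm and its proximal operator -/

theorem posZeroNorm_eq_card {n : ℕ} (u : Vec n) :
    posZeroNorm u = ((Finset.univ.filter fun i => 0 < u i).card : ℝ) := by
  unfold posZeroNorm hammingNorm
  congr 2
  ext i
  simp

theorem posZeroNorm_nonneg {n : ℕ} (u : Vec n) : 0 ≤ posZeroNorm u := by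
  rw [posZeroNorm_eq_card]
  positivity

/-- Positivity is an open condition, so the count of positive entries cannot drop locally; this is
its lower semicontinuity. -/
theorem eventually_pos_of_pos {n : ℕ} (u : Vec n) :
    ∀ᶠ y in 𝓝 u, ∀ i, 0 < u i → 0 < y i := by
  refine eventually_all.2 fun i => ?_
  by_cases hi : 0 < u i
  · have hc : Continuous fun y : Vec n => y i := by fun_prop
    filter_upwards [hc.continuousAt.eventually (lt_mem_nhds hi)] with y hy _ using hy
  · exact Eventually.of_forall fun y h => absurd h hi

theorem posZeroNorm_mono {n : ℕ} {u y : Vec n} (h : ∀ i, 0 < u i → 0 < y i) :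
    posZeroNorm u ≤ posZeroNorm y := by
  rw [posZeroNorm_eq_card, posZeroNorm_eq_card]
  refine Nat.cast_le.2 (Finset.card_le_card fun i hi => ?_)
  simpa using h i (by simpa using hi)

theorem posZeroNorm_add_one_le {n : ℕ} {u y : Vec n} (h : ∀ i, 0 < u i → 0 < y i) {j : Fin n}
    (hu : u j ≤ 0) (hy : 0 < y j) : posZeroNorm u + 1 ≤ posZeroNorm y := by
  rw [posZeroNorm_eq_card, posZeroNorm_eq_card]
  have hlt : (Finset.univ.filter fun i => 0 < u i) ⊂ Finset.univ.filter fun i => 0 < y i := by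
    refine Finset.ssubset_iff_of_subset (fun i hi => ?_) |>.2
      ⟨j, by simpa using hy, by simpa using hu⟩
    simpa using h i (by simpa using hi)
  exact_mod_cast Finset.card_lt_card hlt

/-- Outside the ball of radius `√(2αg(z))` the quadratic term alone exceeds `g z`; inside, lower
semicontinuity and compactness give a minimizer. Nonemptiness matters because `Metric.infDist` to
the empty set is `0`. -/
theorem posProx_nonempty {n : ℕ} {lam α : ℝ} (hlam : 0 < lam) (hα : 0 < α) (z : Vec n) :
    (posProx lam α z).Nonempty := by
  set g : Vec n → ℝ := fun u => lam * posZeroNorm u + 1 / (2 * α) * ‖u - z‖ ^ 2 with hg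
  have hlsc : LowerSemicontinuous g := by
    refine LowerSemicontinuous.add ?_ (by fun_prop : Continuous _).lowerSemicontinuous
    intro u c hc
    filter_upwards [eventually_pos_of_pos u] with y hy
    exact hc.trans_le (mul_le_mul_of_nonneg_left (posZeroNorm_mono hy) hlam.le)
  have hz : 0 ≤ g z := by
    have := posZeroNorm_nonneg z
    positivity
  obtain ⟨u, -, hu⟩ := (hlsc.lowerSemicontinuousOn _).exists_isMinOn
    ⟨z, Metric.mem_closedBall_self (Real.sqrt_nonneg (2 * α * g z))⟩
    (isCompact_closedBall z (Real.sqrt (2 * α * g z)))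
  refine ⟨u, fun y => ?_⟩
  by_cases hy : y ∈ Metric.closedBall z (Real.sqrt (2 * α * g z))
  · exact hu hy
  · have h₁ : g u ≤ g z := hu (Metric.mem_closedBall_self (Real.sqrt_nonneg _))
    rw [Metric.mem_closedBall, not_le, dist_eq_norm] at hy
    replace hy := (Real.sqrt_lt' ((Real.sqrt_nonneg _).trans_lt hy)).1 hy
    have h₂ : g z ≤ 1 / (2 * α) * ‖y - z‖ ^ 2 := by
      rw [one_div, le_inv_mul_iff₀ (by positivity)]
      exact hy.le
    have h₃ := mul_nonneg hlam.le (posZeroNorm_nonneg y)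
    calc g u ≤ g z := h₁
      _ ≤ lam * posZeroNorm y + 1 / (2 * α) * ‖y - z‖ ^ 2 := by linarith

theorem mem_posProx_of_tendsto {n : ℕ} {lam α : ℝ} (hlam : 0 < lam) {s y : ℕ → Vec n}
    {s₀ y₀ : Vec n} (hs : Tendsto s atTop (𝓝 s₀)) (hy : Tendsto y atTop (𝓝 y₀))
    (hmem : ∀ k, y k ∈ posProx lam α (s k)) : y₀ ∈ posProx lam α s₀ := by
  intro t
  refine le_of_tendsto_of_tendsto
    (((hy.sub hs).norm.pow 2).const_mul (1 / (2 * α)) |>.const_add (lam * posZeroNorm y₀))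
    (((hs.const_sub t).norm.pow 2).const_mul (1 / (2 * α)) |>.const_add (lam * posZeroNorm t)) ?_
  filter_upwards [hy.eventually (eventually_pos_of_pos y₀)] with k hk
  have := mul_le_mul_of_nonneg_left (posZeroNorm_mono hk) hlam.le
  have h : lam * posZeroNorm (y k) + 1 / (2 * α) * ‖y k - s k‖ ^ 2
    ≤ lam * posZeroNorm t + 1 / (2 * α) * ‖t - s k‖ ^ 2 := hmem k t
  linarith

/-- Moving one coordinate of a prox point without changing its sign does not decrease the
quadratic part of the prox objective. -/
theorem two_mul_le_sq_of_mem_posProx {n : ℕ} {lam α : ℝ} (hα : 0 < α) {u z : Vec n}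
    (h : u ∈ posProx lam α (u + α • z)) (i : Fin n) (t : ℝ) (ht : 0 < u i + t ↔ 0 < u i) :
    2 * (α * z i) * t ≤ t ^ 2 := by
  have hcard : posZeroNorm (u + EuclideanSpace.single i t) = posZeroNorm u := by
    rw [posZeroNorm_eq_card, posZeroNorm_eq_card]
    congr 2
    ext j
    by_cases hj : j = i
    · subst hj; simpa using ht
    · simp [hj]
  have h' := h (u + EuclideanSpace.single i t)
  simp only [hcard, add_le_add_iff_left] at h'
  rw [mul_le_mul_iff_right₀ (by positivity), sub_add_cancel_left, norm_neg, add_sub_add_left_eq_sub,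
    norm_sub_sq_real, PiLp.norm_single, EuclideanSpace.inner_single_left] at h'
  simp at h'
  linarith

theorem eq_zero_of_mem_posProx {n : ℕ} {lam α : ℝ} (hα : 0 < α) {u z : Vec n}
    (h : u ∈ posProx lam α (u + α • z)) {i : Fin n} (hi : u i ≠ 0) : z i = 0 := by
  by_contra hz
  have key : ∀ t, |t| < |u i| → 2 * (α * z i) * t ≤ t ^ 2 := fun t ht => by
    refine two_mul_le_sq_of_mem_posProx hα h i t ?_
    rcases abs_cases t with h₁ | h₁ <;> rcases abs_cases (u i) with h₂ | h₂ <;>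
      constructor <;> intro h₃ <;> linarith
  set a := α * z i with ha
  have ha0 : 0 < |a| := abs_pos.2 (mul_ne_zero hα.ne' hz)
  -- The move `c * a` is at most half of `|u i|`, hence keeps the sign, and `c ≤ 1` contradicts
  -- `2ca² ≤ c²a²`.
  set c := min 1 (|u i| / (2 * |a|)) with hc
  have hc0 : 0 < c := lt_min one_pos (div_pos (abs_pos.2 hi) (by positivity))
  have hc1 : c ≤ 1 := min_le_left _ _
  have hcu : c * (2 * |a|) ≤ |u i| := (le_div_iff₀ (by positivity)).1 (min_le_right _ _)
  have hk := key (c * a) (by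
    rw [abs_mul, abs_of_pos hc0]
    nlinarith [mul_pos hc0 ha0])
  have ha2 : 0 < a ^ 2 := by rw [← sq_abs]; positivity
  nlinarith [mul_pos hc0 ha2]

theorem nonneg_of_mem_posProx {n : ℕ} {lam α : ℝ} (hα : 0 < α) {u z : Vec n}
    (h : u ∈ posProx lam α (u + α • z)) (i : Fin n) : 0 ≤ z i := by
  by_cases hi : u i = 0
  · by_contra! hz
    have haz : α * z i < 0 := mul_neg_of_pos_of_neg hα hz
    have hk := two_mul_le_sq_of_mem_posProx hα h i (α * z i) (by
      rw [hi, zero_add]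
      exact ⟨fun h' => absurd h' haz.not_gt, fun h' => absurd h' (lt_irrefl _)⟩)
    nlinarith [mul_pos_of_neg_of_neg haz haz]
  · exact (eq_zero_of_mem_posProx hα h hi).ge

/-! ### P-stationary points -/

/-- The zero pattern of `Aw + b` determines the pair. With equal patterns, `A(w - w')` and `z - z'`
have disjoint supports and are orthogonal; strong monotonicity of `∇f` gives `w = w'`, and
injectivity of `Aᵀ` gives `z = z'`. -/
theorem finite_setOf_stationary {n p : ℕ} {f : Vec p → ℝ} {σ : ℝ} (hσ : 0 < σ)
    (hf : StrongConvexOn Set.univ σ f) (hd : Differentiable ℝ f) (hn : 0 < n)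
    {A : Matrix (Fin n) (Fin p) ℝ} (hA : A.rank = n) (b : Vec n) (lam : ℝ) {α : ℝ} (hα : 0 < α) :
    {x : Vec p × Vec n | gradient f x.1 + mulE A.transpose x.2 = 0 ∧
      mulE A x.1 + b ∈ posProx lam α (mulE A x.1 + b + α • x.2)}.Finite := by
  classical
  refine Set.Finite.of_finite_image (f := fun x : Vec p × Vec n =>
    Finset.univ.filter fun i => (mulE A x.1 + b) i = 0) (Set.toFinite _) ?_
  rintro ⟨w, z⟩ ⟨h₁, h₂⟩ ⟨w', z'⟩ ⟨h₁', h₂'⟩ heq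
  have hsupp : ∀ i, (mulE A w + b) i = 0 ↔ (mulE A w' + b) i = 0 := fun i => by
    simpa only [Finset.mem_filter, Finset.mem_univ, true_and] using Finset.ext_iff.1 heq i
  simp only at h₁ h₂ h₁' h₂'
  have horth : inner ℝ (mulE A (w - w')) (z - z') = 0 := by
    have : mulE A (w - w') = (mulE A w + b) - (mulE A w' + b) := by
      simp only [mulE_eq_mulCLM, map_sub]
      abel
    rw [this, PiLp.inner_apply]
    refine Finset.sum_eq_zero fun i _ => ?_
    by_cases hi : (mulE A w + b) i = 0
    · have hi' := (hsupp i).1 hi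
      simp only [PiLp.sub_apply, hi, hi', sub_self, inner_zero_left]
    · have hz := eq_zero_of_mem_posProx hα h₂ hi
      have hz' := eq_zero_of_mem_posProx hα h₂' (fun h => hi ((hsupp i).2 h))
      simp only [PiLp.sub_apply, hz, hz', sub_self, inner_zero_right]
  have hgrad : gradient f w - gradient f w' = -mulE A.transpose (z - z') := by
    rw [eq_neg_of_add_eq_zero_left h₁, eq_neg_of_add_eq_zero_left h₁']
    simp only [mulE_eq_mulCLM, map_sub]
    abel
  have hw : w = w' := by
    have h := hf.mul_norm_sq_le_inner_gradient hd w w'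
    rw [hgrad, inner_neg_left, real_inner_comm, ← inner_mulE, horth, neg_zero] at h
    have h0 : ‖w - w'‖ ^ 2 ≤ 0 := by
      by_contra! hc
      nlinarith [mul_pos hσ hc]
    exact sub_eq_zero.1 (norm_eq_zero.1 (pow_eq_zero_iff two_ne_zero |>.1
      (le_antisymm h0 (sq_nonneg _))))
  subst hw
  have hz : mulE A.transpose (z - z') = 0 := by
    rw [sub_self] at hgrad
    exact neg_eq_zero.1 hgrad.symm
  have h := gammaOf_mul_norm_le hn hA (z - z')
  rw [hz, norm_zero] at h
  have hzz : ‖z - z'‖ ≤ 0 := by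
    by_contra! hc
    nlinarith [mul_pos (gammaOf_pos hn hA) hc]
  rw [sub_eq_zero.1 (norm_le_zero_iff.1 hzz)]

theorem isLocalMinimizer_of_stationary {n p : ℕ} {f : Vec p → ℝ} {σ : ℝ} (hσ : 0 < σ)
    (hf : StrongConvexOn Set.univ σ f) (hd : Differentiable ℝ f)
    {A : Matrix (Fin n) (Fin p) ℝ} {b : Vec n} {lam : ℝ} (hlam : 0 < lam) {α : ℝ} (hα : 0 < α)
    {w : Vec p} {u z : Vec n} (hgrad : gradient f w + mulE A.transpose z = 0)
    (hprox : u ∈ posProx lam α (u + α • z)) (hfeas : mulE A w + b = u) :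
    IsLocalMinimizer f lam A b w u := by
  refine ⟨hfeas, ?_⟩
  have hcont : Continuous fun x : Vec p × Vec n => inner ℝ z (x.2 - u) := by fun_prop
  have hsmall : ∀ᶠ x : Vec p × Vec n in 𝓝 (w, u), inner ℝ z (x.2 - u) < lam :=
    hcont.continuousAt.eventually (gt_mem_nhds (by simpa using hlam))
  have hsign : ∀ᶠ x : Vec p × Vec n in 𝓝 (w, u), ∀ i, 0 < u i → 0 < x.2 i :=
    (continuous_snd.tendsto (w, u)).eventually (eventually_pos_of_pos u)
  filter_upwards [nhdsWithin_le_nhds hsmall, nhdsWithin_le_nhds hsign, self_mem_nhdsWithin]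
    with x hx₁ hx₂ hx₃
  have hconv := hf.add_inner_gradient_le (hd w) x.1
  have hin : inner ℝ (gradient f w) (x.1 - w) = -inner ℝ z (x.2 - u) := by
    have hx₃' : mulE A x.1 + b = x.2 := hx₃
    rw [eq_neg_of_add_eq_zero_left hgrad, inner_neg_left, real_inner_comm, ← inner_mulE,
      real_inner_comm, ← hfeas, ← hx₃']
    simp only [mulE_eq_mulCLM, map_sub, add_sub_add_right_eq_sub]
  have hnn : 0 ≤ σ / 2 * ‖x.1 - w‖ ^ 2 := by positivity
  have hlow : f w - inner ℝ z (x.2 - u) ≤ f x.1 := by linarith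
  simp only [objective]
  -- A new positive entry costs at least `lam`, more than the linear term can gain nearby. Otherwise
  -- entries with `u i = 0` can only decrease, against `z i ≥ 0`, and the others have `z i = 0`.
  by_cases hj : ∃ j, u j ≤ 0 ∧ 0 < x.2 j
  · obtain ⟨j, hj₁, hj₂⟩ := hj
    have := mul_le_mul_of_nonneg_left (posZeroNorm_add_one_le hx₂ hj₁ hj₂) hlam.le
    linarith
  · push Not at hj
    have hle : inner ℝ z (x.2 - u) ≤ 0 := by
      rw [PiLp.inner_apply]
      refine Finset.sum_nonpos fun i _ => ?_
      by_cases hi : u i = 0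
      · have hz := nonneg_of_mem_posProx hα hprox i
        have hxi := hj i hi.le
        simp only [PiLp.sub_apply, hi, sub_zero, RCLike.inner_apply, conj_trivial]
        exact mul_nonpos_of_nonpos_of_nonneg hxi hz
      · simp [eq_zero_of_mem_posProx hα hprox hi]
    have := mul_le_mul_of_nonneg_left (posZeroNorm_mono hx₂) hlam.le
    linarith

/-! ### Estimates along the iteration -/

/-- At the new iterate the bracket is the updated multiplier, so the stopping test becomes
approximate P-stationarity with `z (k + 1)`. -/
theorem gradient_hFun_snd {n p : ℕ} (f : Vec p → ℝ) (A : Matrix (Fin n) (Fin p) ℝ)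
    (b : Vec n) (ρ μ : ℝ) (z : Vec n) (v w : Vec p) (u : Vec n) :
    gradient (fun y => hFun f A b ρ μ z v w y) u = -(z + ρ • (mulE A w + b - u)) := by
  refine HasGradientAt.gradient (hasGradientAt_iff_hasFDerivAt.2 ?_)
  have h : HasFDerivAt (fun y : Vec n => mulE A w + b - y) (-ContinuousLinearMap.id ℝ (Vec n)) u :=
    (hasFDerivAt_id u).const_sub _
  have h₁ := (((innerSL ℝ z).hasFDerivAt.comp u h).const_add (f w + μ / 2 * ‖w - v‖ ^ 2)).add
    (h.norm_sq.const_mul (ρ / 2))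
  refine h₁.congr_fderiv ?_
  ext y
  simp only [InnerProductSpace.toDual_apply_apply, inner_neg_left, inner_add_left, inner_smul_left,
    add_apply, smul_apply, ContinuousLinearMap.comp_apply,
    neg_apply, ContinuousLinearMap.id_apply, innerSL_apply_apply,
    inner_neg_right, smul_eq_mul, nsmul_eq_mul,
    Nat.cast_ofNat, conj_trivial]
  ring

theorem gradient_hFun_fst {n p : ℕ} {f : Vec p → ℝ} (A : Matrix (Fin n) (Fin p) ℝ)
    (b : Vec n) (ρ μ : ℝ) (z : Vec n) (v : Vec p) {w : Vec p} (u : Vec n)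
    (hd : DifferentiableAt ℝ f w) :
    gradient (fun x => hFun f A b ρ μ z v x u) w
      = gradient f w + μ • (w - v) + mulE A.transpose (z + ρ • (mulE A w + b - u)) := by
  refine HasGradientAt.gradient (hasGradientAt_iff_hasFDerivAt.2 ?_)
  have h : HasFDerivAt (fun x : Vec p => mulE A x + b - u) (mulCLM A) w :=
    ((mulCLM A).hasFDerivAt.add_const b).sub_const u
  have hv : HasFDerivAt (fun x : Vec p => x - v) (ContinuousLinearMap.id ℝ (Vec p)) w :=
    (hasFDerivAt_id w).sub_const v
  have h₁ := ((hd.hasFDerivAt.add (hv.norm_sq.const_mul (μ / 2))).add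
    ((innerSL ℝ z).hasFDerivAt.comp w h)).add (h.norm_sq.const_mul (ρ / 2))
  refine h₁.congr_fderiv ?_
  ext y
  simp only [InnerProductSpace.toDual_apply_apply, inner_add_left, inner_smul_left,
    add_apply, smul_apply, ContinuousLinearMap.comp_apply,
    ContinuousLinearMap.id_apply, innerSL_apply_apply, smul_eq_mul, nsmul_eq_mul,
    Nat.cast_ofNat, conj_trivial,
    inner_gradient_left, ← mulE_eq_mulCLM]
  rw [real_inner_comm y (mulE A.transpose _), ← inner_mulE, real_inner_comm _ (mulE A y),
    inner_add_left, inner_smul_left,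
    conj_trivial]
  ring

section Iteration

variable {n p : ℕ} {f : Vec p → ℝ} {lam : ℝ} {A : Matrix (Fin n) (Fin p) ℝ} {b : Vec n}
  {ρ μ : ℝ} {ε : ℕ → ℝ} {w : ℕ → Vec p} {u z : ℕ → Vec n} {v : ℕ → Vec p}

theorem IsIALMSequence.norm_residual_le (h : IsIALMSequence f lam A b ρ μ ε w u z v)
    (hd : Differentiable ℝ f) (k : ℕ) :
    ‖gradient f (w (k + 1)) + μ • (w (k + 1) - v k) + mulE A.transpose (z (k + 1))‖ ≤ ε k := by
  rw [h.multiplier k, ← gradient_hFun_fst _ _ _ _ _ _ _ (hd _)]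
  exact (le_max_right _ _).trans (h.crit k)

theorem IsIALMSequence.exists_mem_posProx (h : IsIALMSequence f lam A b ρ μ ε w u z v)
    (hlam : 0 < lam) (hρ : 0 < ρ) (hε : ∀ k, 0 < ε k) (k : ℕ) :
    ∃ y ∈ posProx lam (1 / ρ) (u (k + 1) + (1 / ρ) • z (k + 1)),
      dist (u (k + 1)) y < 2 * ε k := by
  have hc := (le_max_left _ _).trans (h.crit k)
  rw [gradient_hFun_snd, ← h.multiplier k, smul_neg, sub_neg_eq_add] at hc
  -- The factor `2` supplies the strict inequality needed to pick a point nearly realizing the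
  -- distance.
  exact (Metric.infDist_lt_iff (posProx_nonempty hlam (by positivity) _)).1
    (hc.trans_lt (by linarith [hε k]))

theorem IsIALMSequence.norm_multiplier_le (h : IsIALMSequence f lam A b ρ μ ε w u z v)
    (hn : 0 < n) (hA : A.rank = n) (hd : Differentiable ℝ f) (hμ : 0 < μ) (k : ℕ) :
    gammaOf A * ‖z (k + 1)‖
      ≤ ‖gradient f (w (k + 1))‖ + μ * ‖w (k + 1) - v k‖ + ε k := by
  refine (gammaOf_mul_norm_le hn hA _).trans ?_
  have hr := h.norm_residual_le hd k
  have hs : mulE A.transpose (z (k + 1)) =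
      (gradient f (w (k + 1)) + μ • (w (k + 1) - v k) + mulE A.transpose (z (k + 1)))
        - gradient f (w (k + 1)) - μ • (w (k + 1) - v k) := by abel
  rw [hs]
  have h₁ := norm_sub_le ((gradient f (w (k + 1)) + μ • (w (k + 1) - v k)
    + mulE A.transpose (z (k + 1))) - gradient f (w (k + 1))) (μ • (w (k + 1) - v k))
  have h₂ := norm_sub_le (gradient f (w (k + 1)) + μ • (w (k + 1) - v k)
    + mulE A.transpose (z (k + 1))) (gradient f (w (k + 1)))
  rw [norm_smul, Real.norm_of_nonneg hμ.le] at h₁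
  linarith

theorem IsIALMSequence.norm_multiplier_sub_le (h : IsIALMSequence f lam A b ρ μ ε w u z v)
    (hn : 0 < n) (hA : A.rank = n) {l : ℝ} (hf : IsSmooth f l) (hμ : 0 < μ) (k : ℕ) :
    gammaOf A * ‖z (k + 2) - z (k + 1)‖
      ≤ (μ + l) * ‖w (k + 2) - v (k + 1)‖ + μ * ‖w (k + 1) - v k‖ + ε (k + 1) + ε k := by
  refine (gammaOf_mul_norm_le hn hA _).trans ?_
  have hr := h.norm_residual_le hf.1 k
  have hr' := h.norm_residual_le hf.1 (k + 1)
  have hl := hf.2 (w (k + 2)) (w (k + 1))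
  rw [← h.lyapunovStep k] at hl
  simp only [add_assoc k 1 1, Nat.reduceAdd] at hr'
  set e := gradient f (w (k + 1)) + μ • (w (k + 1) - v k) + mulE A.transpose (z (k + 1)) with he
  set e' := gradient f (w (k + 2)) + μ • (w (k + 2) - v (k + 1)) + mulE A.transpose (z (k + 2))
    with he'
  have hs : mulE A.transpose (z (k + 2) - z (k + 1)) =
      e' - e - (gradient f (w (k + 2)) - gradient f (v (k + 1))) - μ • (w (k + 2) - v (k + 1))
        + μ • (w (k + 1) - v k) := by
    rw [he, he', h.lyapunovStep k]
    simp only [mulE_eq_mulCLM, map_sub]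
    abel
  rw [hs]
  have h₁ := norm_add_le (e' - e - (gradient f (w (k + 2)) - gradient f (v (k + 1)))
    - μ • (w (k + 2) - v (k + 1))) (μ • (w (k + 1) - v k))
  have h₂ := norm_sub_le (e' - e - (gradient f (w (k + 2)) - gradient f (v (k + 1))))
    (μ • (w (k + 2) - v (k + 1)))
  have h₃ := norm_sub_le (e' - e) (gradient f (w (k + 2)) - gradient f (v (k + 1)))
  have h₄ := norm_sub_le e' e
  rw [norm_smul, Real.norm_of_nonneg hμ.le] at h₁ h₂
  linarith

theorem IsIALMSequence.augLagrangian_add_le (h : IsIALMSequence f lam A b ρ μ ε w u z v)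
    (hρ : 0 < ρ) (k : ℕ) :
    augLagrangian f lam A b ρ (w (k + 2)) (u (k + 2)) (z (k + 2))
        + μ / 2 * ‖w (k + 2) - v (k + 1)‖ ^ 2
      ≤ augLagrangian f lam A b ρ (w (k + 1)) (u (k + 1)) (z (k + 1))
        + ‖z (k + 2) - z (k + 1)‖ ^ 2 / ρ := by
  have hdesc := h.descent (k + 1)
  have hmul := h.multiplier (k + 1)
  simp only [add_assoc k 1 1, Nat.reduceAdd] at hdesc hmul
  -- The index starts at `k + 1` because `v 0` is arbitrary: only from there on does `v = w` cancel
  -- the proximal term on the right.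
  simp only [lyapunov, h.lyapunovStep k, sub_self, norm_zero] at hdesc
  have hz : augLagrangian f lam A b ρ (w (k + 2)) (u (k + 2)) (z (k + 2))
      = augLagrangian f lam A b ρ (w (k + 2)) (u (k + 2)) (z (k + 1))
        + ‖z (k + 2) - z (k + 1)‖ ^ 2 / ρ := by
    rw [hmul, add_sub_cancel_left, norm_smul, Real.norm_of_nonneg hρ.le]
    simp only [augLagrangian, inner_add_left, inner_smul_left, conj_trivial,
      real_inner_self_eq_norm_sq]
    field_simp
    ring
  rw [hz, h.lyapunovStep k]
  linarith

theorem sub_le_augLagrangian (hlam : 0 < lam) (hρ : 0 < ρ) (w : Vec p) (u z : Vec n) :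
    f w - ‖z‖ ^ 2 / (2 * ρ) ≤ augLagrangian f lam A b ρ w u z := by
  have h₁ := mul_nonneg hlam.le (posZeroNorm_nonneg u)
  have h₂ := neg_le_of_abs_le (abs_real_inner_le_norm z (mulE A w + b - u))
  set r := ‖mulE A w + b - u‖ with hr
  have h₃ : 0 ≤ (‖z‖ - ρ * r) ^ 2 / (2 * ρ) := by positivity
  have h₄ : (‖z‖ - ρ * r) ^ 2 / (2 * ρ) = ‖z‖ ^ 2 / (2 * ρ) - ‖z‖ * r + ρ / 2 * r ^ 2 := by
    field_simp
    ring
  simp only [augLagrangian]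
  linarith

/-- The square of a sum of four terms costs a factor `4`. `hbound` makes the `d'` terms fit in `μ /
4`, half of the proximal gain, and `hee` says exactly that the drop of `η e²` pays for both
tolerances. -/
theorem potential_descent_real {γ ρ μ l η d d' e e' t : ℝ} (hγ : 0 < γ) (hρ : 0 < ρ)
    (ht : 0 ≤ t)
    (hbound : 16 * (((μ + l) / γ) ^ 2 + (μ / γ) ^ 2) ≤ ρ * μ)
    (hee : (ρ * γ ^ 2 * η + 4) * e' ^ 2 ≤ (ρ * γ ^ 2 * η - 4) * e ^ 2)
    (h : γ * t ≤ (μ + l) * d' + μ * d + e' + e) :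
    t ^ 2 / ρ + 4 * (μ / γ) ^ 2 / ρ * d' ^ 2 + η * e' ^ 2
      ≤ μ / 4 * d' ^ 2 + 4 * (μ / γ) ^ 2 / ρ * d ^ 2 + η * e ^ 2 := by
  have hsq : (γ * t) ^ 2 ≤ 4 * (((μ + l) * d') ^ 2 + (μ * d) ^ 2 + e' ^ 2 + e ^ 2) := by
    refine (pow_le_pow_left₀ (by positivity) h 2).trans ?_
    nlinarith [sq_nonneg ((μ + l) * d' - μ * d), sq_nonneg ((μ + l) * d' - e'),
      sq_nonneg ((μ + l) * d' - e), sq_nonneg (μ * d - e'), sq_nonneg (μ * d - e),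
      sq_nonneg (e' - e)]
  have hb : 16 * ((μ + l) ^ 2 + μ ^ 2) * d' ^ 2 ≤ ρ * μ * γ ^ 2 * d' ^ 2 := by
    refine mul_le_mul_of_nonneg_right ?_ (sq_nonneg _)
    have := mul_le_mul_of_nonneg_right hbound (sq_nonneg γ)
    calc 16 * ((μ + l) ^ 2 + μ ^ 2)
        = 16 * (((μ + l) / γ) ^ 2 + (μ / γ) ^ 2) * γ ^ 2 := by field_simp
      _ ≤ _ := this
  rw [← sub_nonneg]
  have key : μ / 4 * d' ^ 2 + 4 * (μ / γ) ^ 2 / ρ * d ^ 2 + η * e ^ 2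
      - (t ^ 2 / ρ + 4 * (μ / γ) ^ 2 / ρ * d' ^ 2 + η * e' ^ 2)
      = ((ρ * μ * γ ^ 2 * d' ^ 2 / 4 - 4 * μ ^ 2 * d' ^ 2) + 4 * μ ^ 2 * d ^ 2
        + ρ * γ ^ 2 * η * (e ^ 2 - e' ^ 2) - (γ * t) ^ 2) / (ρ * γ ^ 2) := by
    field_simp
    ring
  rw [key]
  refine div_nonneg ?_ (by positivity)
  nlinarith

/-- Three squares cost a factor `3`; with `g² ≤ 4l(F - m)` and the division by `2ργ²` this yields
the threshold `6l / γ²`. -/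
theorem potential_lower_real {γ ρ μ l η d e m F L g t : ℝ} (hγ : 0 < γ) (hρ : 0 < ρ)
    (ht : 0 ≤ t) (hη : 4 ≤ ρ * γ ^ 2 * η) (hg : g ^ 2 ≤ 4 * l * (F - m))
    (h : γ * t ≤ g + μ * d + e) (hL : F - t ^ 2 / (2 * ρ) ≤ L) :
    m + (1 - 6 * l / γ ^ 2 / ρ) * (F - m)
      ≤ L + 4 * (μ / γ) ^ 2 / ρ * d ^ 2 + η * e ^ 2 := by
  have hsq : (γ * t) ^ 2 ≤ 3 * (g ^ 2 + (μ * d) ^ 2 + e ^ 2) := by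
    refine (pow_le_pow_left₀ (by positivity) h 2).trans ?_
    nlinarith [sq_nonneg (g - μ * d), sq_nonneg (g - e), sq_nonneg (μ * d - e)]
  have hη' : 4 * e ^ 2 ≤ ρ * γ ^ 2 * η * e ^ 2 := mul_le_mul_of_nonneg_right hη (sq_nonneg _)
  have key : F - t ^ 2 / (2 * ρ) + 4 * (μ / γ) ^ 2 / ρ * d ^ 2 + η * e ^ 2
      - (m + (1 - 6 * l / γ ^ 2 / ρ) * (F - m))
      = (12 * l * (F - m) - (γ * t) ^ 2 + 8 * (μ * d) ^ 2 + 2 * (ρ * γ ^ 2 * η * e ^ 2))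
        / (2 * ρ * γ ^ 2) := by
    field_simp
    ring
  have hnn : 0 ≤ (12 * l * (F - m) - (γ * t) ^ 2 + 8 * (μ * d) ^ 2
      + 2 * (ρ * γ ^ 2 * η * e ^ 2)) / (2 * ρ * γ ^ 2) := by
    refine div_nonneg ?_ (by positivity)
    nlinarith [sq_nonneg (μ * d), sq_nonneg e]
  linarith

end Iteration

/-! ### Descent of the potential and convergence of the iterates -/

section Convergence

variable {n p : ℕ} {f : Vec p → ℝ} {lam : ℝ} {A : Matrix (Fin n) (Fin p) ℝ} {b : Vec n}
  {ρ μ : ℝ} {ε : ℕ → ℝ} {w : ℕ → Vec p} {u z : ℕ → Vec n} {v : ℕ → Vec p}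

/-- The potential that decreases along the iteration. -/
noncomputable def potential (f : Vec p → ℝ) (lam : ℝ) (A : Matrix (Fin n) (Fin p) ℝ) (b : Vec n)
    (ρ μ η : ℝ) (ε : ℕ → ℝ) (w : ℕ → Vec p) (u z : ℕ → Vec n) (v : ℕ → Vec p) (k : ℕ) : ℝ :=
  augLagrangian f lam A b ρ (w (k + 1)) (u (k + 1)) (z (k + 1))
    + 4 * (μ / gammaOf A) ^ 2 / ρ * ‖w (k + 1) - v k‖ ^ 2 + η * ε k ^ 2

theorem IsIALMSequence.potential_descent (h : IsIALMSequence f lam A b ρ μ ε w u z v)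
    (hn : 0 < n) (hA : A.rank = n) {l : ℝ} (hf : IsSmooth f l) (hμ : 0 < μ) (hρ : 0 < ρ)
    (hbound : 16 * (((μ + l) / gammaOf A) ^ 2 + (μ / gammaOf A) ^ 2) ≤ ρ * μ) {η : ℝ}
    (hε : ∀ k, (ρ * gammaOf A ^ 2 * η + 4) * ε (k + 1) ^ 2
      ≤ (ρ * gammaOf A ^ 2 * η - 4) * ε k ^ 2) (k : ℕ) :
    potential f lam A b ρ μ η ε w u z v (k + 1) + μ / 4 * ‖w (k + 2) - v (k + 1)‖ ^ 2
      ≤ potential f lam A b ρ μ η ε w u z v k := by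
  have h₁ := h.augLagrangian_add_le hρ k
  have h₂ := potential_descent_real (gammaOf_pos hn hA) hρ (norm_nonneg _) hbound (hε k)
    (h.norm_multiplier_sub_le hn hA hf hμ k)
  simp only [potential, add_assoc k 1 1, Nat.reduceAdd]
  linarith

theorem IsIALMSequence.le_potential (h : IsIALMSequence f lam A b ρ μ ε w u z v)
    (hn : 0 < n) (hA : A.rank = n) (hd : Differentiable ℝ f) {l m : ℝ}
    (hg : ∀ x, ‖gradient f x‖ ^ 2 ≤ 4 * l * (f x - m)) (hlam : 0 < lam) (hμ : 0 < μ) (hρ : 0 < ρ)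
    {η : ℝ} (hη : 4 ≤ ρ * gammaOf A ^ 2 * η) (k : ℕ) :
    m + (1 - 6 * l / gammaOf A ^ 2 / ρ) * (f (w (k + 1)) - m)
      ≤ potential f lam A b ρ μ η ε w u z v k :=
  potential_lower_real (gammaOf_pos hn hA) hρ (norm_nonneg _) hη (hg _)
    (h.norm_multiplier_le hn hA hd hμ k) (sub_le_augLagrangian hlam hρ _ _ _)

theorem continuous_gradient_of_isSmooth {l : ℝ} (hf : IsSmooth f l) : Continuous (gradient f) :=
  (LipschitzWith.of_dist_le' (K := l) fun x y => by
    simpa only [dist_eq_norm] using hf.2 x y).continuous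

theorem IsIALMSequence.stationary_of_tendsto (h : IsIALMSequence f lam A b ρ μ ε w u z v)
    {l : ℝ} (hf : IsSmooth f l) (hlam : 0 < lam) (hρ : 0 < ρ) (hε : ∀ k, 0 < ε k)
    (hε0 : Tendsto ε atTop (𝓝 0)) (hw : Tendsto (fun k => w (k + 1) - v k) atTop (𝓝 0))
    {φ : ℕ → ℕ} (hφ : Tendsto φ atTop atTop) {w₀ : Vec p} {u₀ z₀ : Vec n}
    (hw₀ : Tendsto (fun k => w (φ k + 1)) atTop (𝓝 w₀))
    (hu₀ : Tendsto (fun k => u (φ k + 1)) atTop (𝓝 u₀))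
    (hz₀ : Tendsto (fun k => z (φ k + 1)) atTop (𝓝 z₀)) :
    gradient f w₀ + mulE A.transpose z₀ = 0 ∧ u₀ ∈ posProx lam (1 / ρ) (u₀ + (1 / ρ) • z₀) := by
  constructor
  · have h₀ : Tendsto (fun k => gradient f (w (k + 1)) + μ • (w (k + 1) - v k)
        + mulE A.transpose (z (k + 1))) atTop (𝓝 0) :=
      squeeze_zero_norm (fun k => h.norm_residual_le hf.1 k) hε0
    have h₁ := (((continuous_gradient_of_isSmooth hf).tendsto w₀).comp hw₀).add
      ((hw.comp hφ).const_smul μ) |>.add (((mulCLM A.transpose).continuous.tendsto z₀).comp hz₀)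
    rw [smul_zero, add_zero] at h₁
    exact tendsto_nhds_unique h₁ (h₀.comp hφ)
  · choose y hy hdist using h.exists_mem_posProx hlam hρ hε
    have hd0 : Tendsto (fun k => dist (u (φ k + 1)) (y (φ k))) atTop (𝓝 0) := by
      refine squeeze_zero (fun _ => dist_nonneg) (fun k => (hdist (φ k)).le) ?_
      simpa using (hε0.comp hφ).const_mul 2
    exact mem_posProx_of_tendsto hlam (hu₀.add (hz₀.const_smul (1 / ρ)))
      ((tendsto_iff_of_dist hd0).1 hu₀) fun k => hy (φ k)

theorem IsIALMSequence.exists_tendsto (h : IsIALMSequence f lam A b ρ μ ε w u z v)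
    (hn : 0 < n) (hA : A.rank = n) {l σ : ℝ} (hf : IsSmooth f l) (hσ : 0 < σ)
    (hconv : StrongConvexOn Set.univ σ f) (hlam : 0 < lam) (hμ : 0 < μ) (hρ : 0 < ρ)
    (hε : ∀ k, 0 < ε k) (hε0 : Tendsto ε atTop (𝓝 0))
    (hw : Tendsto (fun k => w (k + 1) - v k) atTop (𝓝 0))
    (hz : Tendsto (fun k => z (k + 2) - z (k + 1)) atTop (𝓝 0)) {R : ℝ}
    (hR : ∀ k, ‖w (k + 1)‖ ≤ R) :
    ∃ w₀ z₀, Tendsto (fun k => w (k + 1)) atTop (𝓝 w₀) ∧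
      Tendsto (fun k => z (k + 1)) atTop (𝓝 z₀) ∧
      Tendsto (fun k => u (k + 1)) atTop (𝓝 (mulE A w₀ + b)) := by
  have hρ' : ρ ≠ 0 := hρ.ne'
  have hr : Tendsto (fun k => mulE A (w (k + 1)) + b - u (k + 1)) atTop (𝓝 0) := by
    rw [← tendsto_add_atTop_iff_nat 1]
    have := hz.const_smul ρ⁻¹
    rw [smul_zero] at this
    refine this.congr fun k => ?_
    have hm := h.multiplier (k + 1)
    simp only [add_assoc k 1 1, Nat.reduceAdd] at hm ⊢
    rw [hm, add_sub_cancel_left, inv_smul_smul₀ hρ']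
  have hu : ∀ {φ : ℕ → ℕ} (_ : Tendsto φ atTop atTop) {w₀ : Vec p}
      (_ : Tendsto (fun k => w (φ k + 1)) atTop (𝓝 w₀)),
      Tendsto (fun k => u (φ k + 1)) atTop (𝓝 (mulE A w₀ + b)) := fun {φ} hφ {w₀} hw₀ => by
    have h₁ := ((((mulCLM A).continuous.tendsto w₀).comp hw₀).add_const b).sub (hr.comp hφ)
    rw [sub_zero] at h₁
    refine h₁.congr fun k => ?_
    simp only [Function.comp_apply, mulE_eq_mulCLM]
    abel
  obtain ⟨B, hB⟩ := hw.norm.bddAbove_range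
  obtain ⟨C, hC⟩ := hε0.bddAbove_range
  have hγ := gammaOf_pos hn hA
  obtain ⟨M, hM⟩ := (isCompact_closedBall (0 : Vec p) R).exists_bound_of_continuousOn
    (continuous_gradient_of_isSmooth hf).continuousOn
  have hzb : ∀ k, ‖z (k + 1)‖ ≤ (M + μ * B + C) / gammaOf A := fun k => by
    rw [le_div_iff₀' hγ]
    refine (h.norm_multiplier_le hn hA hf.1 hμ k).trans ?_
    have h₁ := hM (w (k + 1)) (by simpa using hR k)
    have h₂ := mul_le_mul_of_nonneg_left (hB ⟨k, rfl⟩) hμ.le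
    have h₃ := hC ⟨k, rfl⟩
    linarith
  -- Only `(w, z)` needs tracking: the vanishing residual recovers `u` as `Aw + b` in the limit.
  obtain ⟨c, hc⟩ := exists_tendsto_of_finite_mapClusterPt
    (x := fun k => (w (k + 1), z (k + 1)))
    ((isCompact_closedBall (0 : Vec p) R).prod
      (isCompact_closedBall (0 : Vec n) ((M + μ * B + C) / gammaOf A)))
    (fun k => ⟨by simpa using hR k, by simpa using hzb k⟩)
    (by
      simp only [dist_eq_norm, add_assoc, Nat.reduceAdd]
      have h₁ : Tendsto (fun k => ‖w (k + 2) - w (k + 1)‖) atTop (𝓝 0) := by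
        have := (hw.comp (tendsto_add_atTop_nat 1)).norm
        rw [norm_zero] at this
        refine this.congr fun k => ?_
        simp only [Function.comp_apply, h.lyapunovStep k, add_assoc, Nat.reduceAdd]
      have h₂ := hz.norm
      rw [norm_zero] at h₂
      simpa using h₁.max h₂)
    ((finite_setOf_stationary hσ hconv hf.1 hn hA b lam
      (one_div_pos.2 hρ)).subset fun c hc => by
        obtain ⟨φ, hφ, hlim⟩ := MapClusterPt.tendsto_subseq hc
        have hw₀ := (continuous_fst.tendsto c).comp hlim
        have hz₀ := (continuous_snd.tendsto c).comp hlim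
        exact h.stationary_of_tendsto hf hlam hρ hε hε0 hw hφ.tendsto_atTop hw₀
          (hu hφ.tendsto_atTop hw₀) hz₀)
  have hw₀ := (continuous_fst.tendsto c).comp hc
  exact ⟨c.1, c.2, hw₀, (continuous_snd.tendsto c).comp hc, hu tendsto_id hw₀⟩

end Convergence

theorem tendsto_zero_of_potential {Φ d : ℕ → ℝ} {m c : ℝ} (hc : 0 < c)
    (hΦ : ∀ k, Φ (k + 1) + c * d (k + 1) ^ 2 ≤ Φ k) (hm : ∀ k, m ≤ Φ k) :
    Antitone Φ ∧ Tendsto d atTop (𝓝 0) := by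
  have hanti : Antitone Φ := antitone_nat_of_succ_le fun k =>
    le_trans (by have := mul_nonneg hc.le (sq_nonneg (d (k + 1))); linarith) (hΦ k)
  refine ⟨hanti, ?_⟩
  have hlim := tendsto_atTop_ciInf hanti ⟨m, by rintro _ ⟨k, rfl⟩; exact hm k⟩
  have hdiff := (hlim.sub (hlim.comp (tendsto_add_atTop_nat 1))).const_mul c⁻¹
  rw [sub_self, mul_zero] at hdiff
  have hsq : Tendsto (fun k => d (k + 1) ^ 2) atTop (𝓝 0) := by
    refine squeeze_zero (fun k => sq_nonneg _) (fun k => ?_) hdiff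
    rw [Function.comp_apply, le_inv_mul_iff₀ hc]
    linarith [hΦ k]
  rw [← tendsto_add_atTop_iff_nat 1]
  have := hsq.sqrt
  simp only [Real.sqrt_sq_eq_abs, Real.sqrt_zero] at this
  exact (tendsto_zero_iff_abs_tendsto_zero _).2 this

theorem tendsto_zero_of_ratio_le {ε : ℕ → ℝ} {q : ℝ} (hε : ∀ k, 0 < ε k) (hq : q < 1)
    (h : ∀ k, ε (k + 1) / ε k ≤ q) : Tendsto ε atTop (𝓝 0) := by
  have hq0 : 0 ≤ q := (div_pos (hε 1) (hε 0)).le.trans (h 0)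
  have hle : ∀ k, ε k ≤ ε 0 * q ^ k := fun k => by
    induction k with
    | zero => simp
    | succ k ih =>
      calc ε (k + 1) ≤ q * ε k := (div_le_iff₀ (hε k)).1 (h k)
        _ ≤ q * (ε 0 * q ^ k) := mul_le_mul_of_nonneg_left ih hq0
        _ = ε 0 * q ^ (k + 1) := by ring
  refine squeeze_zero (fun k => (hε k).le) hle ?_
  simpa using (tendsto_pow_atTop_nhds_zero_of_lt_one hq0 hq).const_mul (ε 0)

end ZeroOneCOP

/-! ### Whole sequence convergence -/

theorem mainTheorem1 (n p : ℕ) (hn : 0 < n)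
    (f : ZeroOneCOP.Vec p → ℝ) (lam : ℝ) (hlam : 0 < lam)
    (A : Matrix (Fin n) (Fin p) ℝ) (b : ZeroOneCOP.Vec n)
    (lf : ℝ) (hsmooth : ZeroOneCOP.IsSmooth f lf)
    (hconv : ZeroOneCOP.IsStronglyConvex f)
    (hA : A.rank = n)
    (γ c₁ c₂ : ℝ) (hγ : γ = ZeroOneCOP.gammaOf A)
    (μ : ℝ) (hμ : 0 < μ)
    (hc₁ : c₁ = (μ + lf) / γ) (hc₂ : c₂ = μ / γ)
    (ρ η : ℝ)
    (hρ : max (16 * (c₁ ^ 2 + c₂ ^ 2) / μ) (6 * lf / γ ^ 2) < ρ)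
    (hη : 4 / (ρ * γ ^ 2) < η)
    (ε : ℕ → ℝ) (hε_pos : ∀ k, 0 < ε k)
    (hε : ∀ k, ε (k + 1) / ε k
      ≤ Real.sqrt ((ρ * γ ^ 2 * η - 4) / (ρ * γ ^ 2 * η + 4)))
    (w : ℕ → ZeroOneCOP.Vec p) (u z : ℕ → ZeroOneCOP.Vec n) (v : ℕ → ZeroOneCOP.Vec p)
    (hseq : ZeroOneCOP.IsIALMSequence f lam A b ρ μ ε w u z v) :
    ∃ (wstar : ZeroOneCOP.Vec p) (ustar zstar : ZeroOneCOP.Vec n),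
      Tendsto (fun k => (w k, u k, z k, v k)) atTop (𝓝 (wstar, ustar, zstar, wstar)) ∧
      ZeroOneCOP.IsPStationaryTriplet f lam A b wstar ustar zstar ∧
      ZeroOneCOP.IsLocalMinimizer f lam A b wstar ustar := by
  obtain ⟨σ, hσ, hsc⟩ := hconv
  have hγ0 : 0 < γ := hγ ▸ ZeroOneCOP.gammaOf_pos hn hA
  obtain ⟨hρ₁, hρ₂⟩ := max_lt_iff.1 hρ
  have hρ0 : 0 < ρ := lt_of_le_of_lt (by positivity) hρ₁
  have hnp : n ≤ p := hA ▸ A.rank_le_width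
  -- Full row rank forces `p > 0`; on a nontrivial space strong convexity makes the Lipschitz
  -- constant positive.
  have : Nonempty (Fin p) := ⟨⟨0, hn.trans_le hnp⟩⟩
  have hlf : 0 < lf := lipschitz_const_pos hσ hsc hsmooth.1 hsmooth.2
  obtain ⟨m, hm⟩ := hsc.exists_lower_bound hσ hsmooth.1
  have hmle : ∀ x, m ≤ f x := fun x =>
    le_trans (by have : 0 ≤ σ / 4 * ‖x‖ ^ 2 := by positivity
                 linarith) (hm x)
  have hgrad := norm_gradient_sq_le_of_lower_bound hσ hsc hsmooth.1 hlf hsmooth.2 hmle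
  have hbound : 16 * (((μ + lf) / γ) ^ 2 + (μ / γ) ^ 2) ≤ ρ * μ := by
    rw [← hc₁, ← hc₂]
    exact ((div_lt_iff₀ hμ).1 hρ₁).le
  have hκ : 0 < 1 - 6 * lf / γ ^ 2 / ρ := sub_pos.2 ((div_lt_one hρ0).2 hρ₂)
  have hx : 4 < ρ * γ ^ 2 * η := (div_lt_iff₀' (by positivity)).1 hη
  have hq : (ρ * γ ^ 2 * η - 4) / (ρ * γ ^ 2 * η + 4) < 1 := by
    rw [div_lt_one (by linarith)]
    linarith
  have hq0 : 0 ≤ (ρ * γ ^ 2 * η - 4) / (ρ * γ ^ 2 * η + 4) :=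
    div_nonneg (by linarith) (by linarith)
  have hε0 : Tendsto ε atTop (𝓝 0) :=
    ZeroOneCOP.tendsto_zero_of_ratio_le hε_pos
      (by rwa [Real.sqrt_lt' one_pos, one_pow]) hε
  have hε2 : ∀ k, (ρ * γ ^ 2 * η + 4) * ε (k + 1) ^ 2 ≤ (ρ * γ ^ 2 * η - 4) * ε k ^ 2 := by
    intro k
    have h₁ := pow_le_pow_left₀ (div_pos (hε_pos (k + 1)) (hε_pos k)).le (hε k) 2
    rw [Real.sq_sqrt hq0, div_pow, div_le_div_iff₀ (pow_pos (hε_pos k) 2) (by linarith)] at h₁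
    linarith
  subst hγ
  have hlow := hseq.le_potential hn hA hsmooth.1 hgrad hlam hμ hρ0 hx.le
  obtain ⟨hanti, hd⟩ := ZeroOneCOP.tendsto_zero_of_potential
    (d := fun k => ‖w (k + 1) - v k‖) (m := m) (by positivity : 0 < μ / 4)
    (hseq.potential_descent hn hA hsmooth hμ hρ0 hbound hε2)
    (fun k => le_trans (by
      have := mul_nonneg hκ.le (sub_nonneg.2 (hmle (w (k + 1))))
      linarith) (hlow k))
  have hw := tendsto_zero_iff_norm_tendsto_zero.2 hd
  have hz : Tendsto (fun k => z (k + 2) - z (k + 1)) atTop (𝓝 0) := by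
    have hd' := hd.comp (tendsto_add_atTop_nat 1)
    have hε' := hε0.comp (tendsto_add_atTop_nat 1)
    refine squeeze_zero_norm (fun k => (le_div_iff₀' hγ0).2
      (hseq.norm_multiplier_sub_le hn hA hsmooth hμ k)) ?_
    simpa [Function.comp_def, add_assoc] using
      ((((hd'.const_mul (μ + lf)).add (hd.const_mul μ)).add hε').add hε0).div_const
        (ZeroOneCOP.gammaOf A)
  have hR : ∃ R, ∀ k, ‖w (k + 1)‖ ≤ R := by
    set P := ZeroOneCOP.potential f lam A b ρ μ η ε w u z v 0 with hP
    set κ := 1 - 6 * lf / ZeroOneCOP.gammaOf A ^ 2 / ρ with hκdef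
    -- The potential bounds `κ (f - m)` by `P - m`, and `f - m` dominates `σ / 4 * ‖w‖²`.
    refine ⟨Real.sqrt ((P - m) / κ / (σ / 4)), fun k => Real.le_sqrt_of_sq_le ?_⟩
    rw [le_div_iff₀ (by positivity), le_div_iff₀ hκ]
    have h₁ := (hlow k).trans (hanti (Nat.zero_le k))
    have h₂ := mul_le_mul_of_nonneg_right (hm (w (k + 1))) hκ.le
    linarith
  obtain ⟨R, hR⟩ := hR
  obtain ⟨w₀, z₀, hw₀, hz₀, hu₀⟩ := hseq.exists_tendsto hn hA hsmooth hσ hsc hlam hμ hρ0 hε_pos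
    hε0 hw hz hR
  obtain ⟨hstat, hprox⟩ := hseq.stationary_of_tendsto hsmooth hlam hρ0 hε_pos hε0 hw
    tendsto_id hw₀ hu₀ hz₀
  have hv₀ : Tendsto (fun k => v (k + 1)) atTop (𝓝 w₀) :=
    hw₀.congr fun k => (hseq.lyapunovStep k).symm
  refine ⟨w₀, ZeroOneCOP.mulE A w₀ + b, z₀, ?_, ⟨1 / ρ, by positivity, hstat, hprox, sub_self _⟩,
    ZeroOneCOP.isLocalMinimizer_of_stationary hσ hsc hsmooth.1 hlam (by positivity) hstat hprox rfl⟩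
  exact ((tendsto_add_atTop_iff_nat 1).1 hw₀).prodMk_nhds
    (((tendsto_add_atTop_iff_nat 1).1 hu₀).prodMk_nhds
      (((tendsto_add_atTop_iff_nat 1).1 hz₀).prodMk_nhds ((tendsto_add_atTop_iff_nat 1).1 hv₀)))
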